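/- Let $1<p<\infty$ and let $\lambda$ be Lebesgue measure on $[0,1]$. The Lorentz space $L_{p,\infty}[0,1]$ consists of all (classes modulo a.e. equality of) measurable functions $f:[0,1]\to\mathbb R$ with $$\|f\|_{p,\infty}:=\sup_{t>0} t\,\lambda(\{x\in[0,1]:|f(x)|>t\})^{1/p}<\infty ,$$ with the a.e. pointwise order. Equip it with the complete lattice norm $$\|f\|:=\sup\Big\{\lambda(E)^{\frac1p-1}\int_E|f|\,d\lambda \;:\; E\subset[0,1] \text{ measurable},\ \lambda(E)>0\Big\},$$ so that $L_{p,\infty}[0,1]$ is a Banach lattice. This norm is equivalent to the quasi-norm: $\|f\|_{p,\infty}\le\|f\|\le\frac{p}{p-1}\|f\|_{p,\infty}$ for every $f$. A Banach lattice $X$ is called IWCG (resp. BWCG) if there is a weakly compact set $K\subset X$ such that the smallest closed ideal (resp. closed band) of $X$ containing $K$ is $X$. A positive element $u\in X$ is a quasi-interior point if $\|x-x\wedge nu\|\to0$ as $n\to\infty$ for every $x\ge 0$ in $X$, and a weak order unit if $|x|\wedge u=0$ implies $x=0$ for $x \in X$. Then $\chi_{[0,1]}$ is a weak order unit of $L_{p,\infty}[0,1]$,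 and $L_{p,\infty}[0,1]$ is BWCG; but $L_{p,\infty}[0,1]$ has no quasi-interior point, and it is not IWCG. -/

import Mathlib

open MeasureTheory Set Filter Topology
open scoped ENNReal unitInterval

/-! ### Banach lattices, ideals, bands -/

/-- A (real) Banach lattice: a complete normed vector lattice whose norm is a lattice norm,
that is, `|x| ≤ |y|` implies `‖x‖ ≤ ‖y‖`. -/
class IsBanachLattice (X : Type*) [NormedAddCommGroup X] [NormedSpace ℝ X] [Lattice X] : Prop
    extends IsOrderedAddMonoid X, IsOrderedModule ℝ X, HasSolidNorm X, CompleteSpace X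

section BanachLattice

variable {X : Type*} [NormedAddCommGroup X] [NormedSpace ℝ X] [Lattice X]

/-- Closed ideals: closed subspaces `Y` such that `|x| ≤ |y|` and `y ∈ Y` imply `x ∈ Y`. -/
structure IsClosedIdeal (Y : Submodule ℝ X) : Prop where
  isClosed : IsClosed (Y : Set X)
  solid : ∀ ⦃x y : X⦄, |x| ≤ |y| → y ∈ Y → x ∈ Y

/-- Closed bands: closed ideals containing the supremum of each of their subsets that has
a supremum in `X`. -/
structure IsClosedBand (Z : Submodule ℝ X) : Prop extends IsClosedIdeal Z where
  isLUB_mem : ∀ ⦃A : Set X⦄ ⦃s : X⦄, A ⊆ Z → IsLUB A s → s ∈ Z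

/-- `I(A)`: the smallest closed ideal containing `A`. -/
def idealGenerated (A : Set X) : Submodule ℝ X :=
  sInf {Y | IsClosedIdeal Y ∧ A ⊆ Y}

/-- `B(A)`: the smallest closed band containing `A`. -/
def bandGenerated (A : Set X) : Submodule ℝ X :=
  sInf {Z | IsClosedBand Z ∧ A ⊆ Z}

/-- Compactness in the weak topology `σ(X, X*)`. -/
def IsWeaklyCompact (K : Set X) : Prop :=
  IsCompact (toWeakSpace ℝ X '' K)

/-- A quasi-interior point: a positive `u` with `‖x - x ⊓ n u‖ → 0` for every `x ≥ 0`. -/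
def IsQuasiInteriorPoint (u : X) : Prop :=
  0 ≤ u ∧ ∀ x : X, 0 ≤ x → Tendsto (fun n : ℕ => ‖x - x ⊓ (n : ℝ) • u‖) atTop (𝓝 0)

/-- A weak order unit: a positive `u` whose disjoint complement is `{0}`. -/
def IsWeakOrderUnit (u : X) : Prop :=
  0 ≤ u ∧ ∀ x : X, |x| ⊓ |u| = 0 → x = 0

end BanachLattice

section Generated

variable (X : Type*) [NormedAddCommGroup X] [NormedSpace ℝ X] [Lattice X] [IsBanachLattice X]

/-- `X` is weakly compactly generated as an ideal. -/
def IsIWCG : Prop :=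
  ∃ K : Set X, IsWeaklyCompact K ∧ idealGenerated K = ⊤

/-- `X` is weakly compactly generated as a band. -/
def IsBWCG : Prop :=
  ∃ K : Set X, IsWeaklyCompact K ∧ bandGenerated K = ⊤

end Generated

/-! ### The Lorentz space `L_{p,∞}[0,1]` -/

namespace Lorentz

/-- Equivalence classes (modulo a.e. equality for Lebesgue measure) of measurable functions
`[0,1] → ℝ`. -/
abbrev L0 : Type := I →ₘ[(volume : Measure I)] ℝ

/-- The quasi-norm `‖f‖_{p,∞} = sup_{t > 0} t λ({x : |f x| > t})^{1/p}`, with values in `[0,∞]`. -/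
noncomputable def quasiNorm (p : ℝ) (f : L0) : ℝ≥0∞ :=
  ⨆ (t : ℝ) (_ : 0 < t), ENNReal.ofReal t * volume {x : I | t < |f x|} ^ (1 / p)

/-- The equivalent lattice norm `sup_E λ(E)^{1/p - 1} ∫_E |f| dλ = sup_{t > 0} t^{1/p} f**(t)`,
with values in `[0,∞]`; the supremum is over the measurable subsets `E` of `[0,1]`, and null sets
contribute `0`. -/
noncomputable def maxNorm (p : ℝ) (f : L0) : ℝ≥0∞ :=
  ⨆ (E : Set I) (_ : MeasurableSet E), volume E ^ (1 / p - 1) * ∫⁻ x in E, ‖f x‖ₑ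

lemma le_maxNorm (p : ℝ) (f : L0) {E : Set I} (hE : MeasurableSet E) :
    volume E ^ (1 / p - 1) * ∫⁻ x in E, ‖f x‖ₑ ≤ maxNorm p f :=
  le_iSup₂ (f := fun (E : Set I) (_ : MeasurableSet E) =>
    volume E ^ (1 / p - 1) * ∫⁻ x in E, ‖f x‖ₑ) E hE

lemma maxNorm_mono {p : ℝ} {f g : L0} (h : |f| ≤ |g|) : maxNorm p f ≤ maxNorm p g := by
  refine iSup₂_mono fun E hE => ?_
  gcongr 1
  refine lintegral_mono_ae (ae_restrict_of_ae ?_)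
  rw [← AEEqFun.coeFn_le] at h
  filter_upwards [h, AEEqFun.coeFn_abs f, AEEqFun.coeFn_abs g] with x hx hf hg
  rw [hf, hg] at hx
  rw [Real.enorm_eq_ofReal_abs, Real.enorm_eq_ofReal_abs]
  exact ENNReal.ofReal_le_ofReal hx

lemma maxNorm_add (p : ℝ) (f g : L0) : maxNorm p (f + g) ≤ maxNorm p f + maxNorm p g := by
  refine iSup₂_le fun E hE => ?_
  calc volume E ^ (1 / p - 1) * ∫⁻ x in E, ‖(f + g) x‖ₑ
      ≤ volume E ^ (1 / p - 1) * ((∫⁻ x in E, ‖f x‖ₑ) + ∫⁻ x in E, ‖g x‖ₑ) := by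
        gcongr 1
        rw [← lintegral_add_left' f.aestronglyMeasurable.enorm.restrict]
        refine lintegral_mono_ae (ae_restrict_of_ae ?_)
        filter_upwards [AEEqFun.coeFn_add f g] with x hx
        rw [hx]
        exact enorm_add_le _ _
    _ = volume E ^ (1 / p - 1) * (∫⁻ x in E, ‖f x‖ₑ)
        + volume E ^ (1 / p - 1) * (∫⁻ x in E, ‖g x‖ₑ) := mul_add _ _ _
    _ ≤ _ := add_le_add (le_maxNorm p f hE) (le_maxNorm p g hE)

lemma maxNorm_smul (p : ℝ) (c : ℝ) (f : L0) : maxNorm p (c • f) = ‖c‖ₑ * maxNorm p f := by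
  simp only [maxNorm, ENNReal.mul_iSup]
  refine iSup_congr fun E => iSup_congr fun _ => ?_
  have : ∫⁻ x in E, ‖(c • f) x‖ₑ = ‖c‖ₑ * ∫⁻ x in E, ‖f x‖ₑ := by
    rw [← lintegral_const_mul' _ _ enorm_ne_top]
    refine lintegral_congr_ae (ae_restrict_of_ae ?_)
    filter_upwards [AEEqFun.coeFn_smul c f] with x hx
    rw [hx, Pi.smul_apply, enorm_smul]
  rw [this]
  ring

lemma lintegral_le_maxNorm (p : ℝ) (f : L0) : ∫⁻ x, ‖f x‖ₑ ≤ maxNorm p f := by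
  simpa using le_maxNorm p f MeasurableSet.univ

lemma maxNorm_eq_zero {p : ℝ} {f : L0} (h : maxNorm p f = 0) : f = 0 := by
  have h0 : ∫⁻ x, ‖f x‖ₑ = 0 := le_antisymm ((lintegral_le_maxNorm p f).trans h.le) bot_le
  rw [lintegral_eq_zero_iff' f.aestronglyMeasurable.enorm] at h0
  refine AEEqFun.ext ?_
  filter_upwards [h0, AEEqFun.coeFn_zero (α := I) (μ := volume) (β := ℝ)] with x hx h0x
  rw [h0x]
  simpa using hx

lemma maxNorm_zero (p : ℝ) : maxNorm p (0 : L0) = 0 := by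
  simpa using maxNorm_smul p 0 (0 : L0)

lemma quasiNorm_le_maxNorm {p : ℝ} (hp : 1 < p) (f : L0) : quasiNorm p f ≤ maxNorm p f := by
  refine iSup₂_le fun t ht => ?_
  set E : Set I := {x : I | t < |f x|} with hEdef
  have hE : MeasurableSet E := measurableSet_lt measurable_const f.measurable.abs
  refine le_trans ?_ (le_maxNorm p f hE)
  have hp0 : 0 < p := by linarith
  rcases eq_or_ne (volume E) 0 with h0 | h0
  · rw [h0, ENNReal.zero_rpow_of_pos (by positivity), mul_zero]
    exact bot_le
  have h1 : ENNReal.ofReal t * volume E ≤ ∫⁻ x in E, ‖f x‖ₑ := by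
    rw [← setLIntegral_const]
    refine setLIntegral_mono' hE fun x hx => ?_
    rw [Real.enorm_eq_ofReal_abs]
    exact ENNReal.ofReal_le_ofReal (le_of_lt hx)
  calc ENNReal.ofReal t * volume E ^ (1 / p)
      = volume E ^ (1 / p - 1) * (ENNReal.ofReal t * volume E) := by
        have : volume E ^ (1 / p) = volume E ^ (1 / p - 1) * volume E := by
          conv_rhs => rw [← ENNReal.rpow_one (volume E), ← ENNReal.rpow_mul, one_mul]
          rw [← ENNReal.rpow_add _ _ h0 (measure_ne_top _ _), sub_add_cancel]
        rw [this]
        ring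
    _ ≤ _ := by gcongr

lemma setLIntegral_le {p Q : ℝ} (hp : 1 < p) (hQ : 0 < Q) {f : L0}
    (h : quasiNorm p f ≤ ENNReal.ofReal Q) {E : Set I} (h0 : volume E ≠ 0) :
    ∫⁻ x in E, ‖f x‖ₑ ≤
      ENNReal.ofReal (p / (p - 1) * Q * (volume E).toReal ^ (1 - 1 / p)) := by
  have hp0 : 0 < p := by linarith
  have hp1 : 0 < p - 1 := by linarith
  set m := (volume E).toReal with hm
  have hmpos : 0 < m := ENNReal.toReal_pos h0 (measure_ne_top _ _)
  have hmE : volume E = ENNReal.ofReal m := (ENNReal.ofReal_toReal (measure_ne_top _ _)).symm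
  have hdist : ∀ t : ℝ, 0 < t → volume {x : I | t < |f x|} ≤ ENNReal.ofReal (Q ^ p * t ^ (-p)) := by
    intro t ht
    have h1 : ENNReal.ofReal t * volume {x : I | t < |f x|} ^ (1 / p) ≤ ENNReal.ofReal Q :=
      le_trans (le_iSup₂ (f := fun (t : ℝ) (_ : 0 < t) =>
        ENNReal.ofReal t * volume {x : I | t < |f x|} ^ (1 / p)) t ht) h
    have h2 : volume {x : I | t < |f x|} ^ (1 / p) ≤ ENNReal.ofReal (Q / t) := by
      rw [ENNReal.ofReal_div_of_pos ht, ENNReal.le_div_iff_mul_le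
        (Or.inl (by simpa using ht)) (Or.inl ENNReal.ofReal_ne_top), mul_comm]
      exact h1
    have h3 := ENNReal.rpow_le_rpow h2 hp0.le
    rw [← ENNReal.rpow_mul, one_div_mul_cancel hp0.ne', ENNReal.rpow_one,
      ENNReal.ofReal_rpow_of_pos (by positivity), Real.div_rpow hQ.le ht.le, div_eq_mul_inv,
      ← Real.rpow_neg ht.le] at h3
    exact h3
  set s := Q * m ^ (-(1 / p)) with hs
  have hspos : 0 < s := by positivity
  have hlayer : ∫⁻ x in E, ‖f x‖ₑ
      = ∫⁻ t in Ioi (0 : ℝ), (volume.restrict E) {x : I | t < |f x|} := by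
    simp_rw [Real.enorm_eq_ofReal_abs]
    exact lintegral_eq_lintegral_meas_lt (volume.restrict E)
      (Eventually.of_forall fun x => abs_nonneg _) f.measurable.abs.aemeasurable
  have hint := integrableOn_Ioi_rpow_of_lt (a := -p) (by linarith) hspos
  rw [hlayer, ← Ioc_union_Ioi_eq_Ioi hspos.le,
    lintegral_union measurableSet_Ioi (Ioc_disjoint_Ioi le_rfl)]
  have hA : ∫⁻ t in Ioc 0 s, (volume.restrict E) {x : I | t < |f x|}
      ≤ ENNReal.ofReal (m * s) := by
    calc _ ≤ ∫⁻ t in Ioc 0 s, ENNReal.ofReal m := by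
          refine lintegral_mono fun t => ?_
          refine (measure_mono (subset_univ _)).trans ?_
          rw [Measure.restrict_apply_univ, hmE]
      _ = _ := by
          rw [setLIntegral_const, Real.volume_Ioc, sub_zero, ENNReal.ofReal_mul hmpos.le]
  have hB : ∫⁻ t in Ioi s, (volume.restrict E) {x : I | t < |f x|}
      ≤ ENNReal.ofReal (Q ^ p * (s ^ (1 - p) / (p - 1))) := by
    calc _ ≤ ∫⁻ t in Ioi s, ENNReal.ofReal (Q ^ p * t ^ (-p)) := by
          refine setLIntegral_mono' measurableSet_Ioi fun t ht => ?_
          exact (Measure.restrict_apply_le _ _).trans (hdist t (hspos.trans ht))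
      _ = _ := by
          rw [← ofReal_integral_eq_lintegral_ofReal (hint.const_mul _)]
          · rw [integral_const_mul, integral_Ioi_rpow_of_lt (by linarith) hspos]
            congr 2
            rw [show -p + 1 = 1 - p by ring, show 1 - p = -(p - 1) by ring, neg_div_neg_eq]
          · filter_upwards [ae_restrict_mem measurableSet_Ioi] with t ht
            have : 0 < t := hspos.trans ht
            simp only [Pi.zero_apply]
            positivity
  refine (add_le_add hA hB).trans ?_
  rw [← ENNReal.ofReal_add (by positivity) (by positivity)]
  refine ENNReal.ofReal_le_ofReal (le_of_eq ?_)
  have e1 : m * s = Q * m ^ (1 - 1 / p) := by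
    rw [hs, show (1 - 1 / p) = 1 + (-(1 / p)) by ring, Real.rpow_add hmpos, Real.rpow_one]
    ring
  have e2 : Q ^ p * s ^ (1 - p) = Q * m ^ (1 - 1 / p) := by
    rw [hs, Real.mul_rpow hQ.le (by positivity), ← Real.rpow_mul hmpos.le, ← mul_assoc,
      ← Real.rpow_add hQ]
    congr 2
    · rw [show p + (1 - p) = 1 by ring, Real.rpow_one]
    · field_simp
      ring
  rw [← mul_div_assoc, e2, e1]
  field_simp
  ring

lemma maxNorm_le_of_quasiNorm_le {p Q : ℝ} (hp : 1 < p) (hQ : 0 < Q) {f : L0}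
    (h : quasiNorm p f ≤ ENNReal.ofReal Q) : maxNorm p f ≤ ENNReal.ofReal (p / (p - 1) * Q) := by
  have hp1 : 0 < p - 1 := by linarith
  refine iSup₂_le fun E _ => ?_
  rcases eq_or_ne (volume E) 0 with h0 | h0
  · rw [setLIntegral_measure_zero _ _ h0, mul_zero]
    exact bot_le
  have hmpos : 0 < (volume E).toReal := ENNReal.toReal_pos h0 (measure_ne_top _ _)
  calc volume E ^ (1 / p - 1) * ∫⁻ x in E, ‖f x‖ₑ
      ≤ ENNReal.ofReal ((volume E).toReal ^ (1 / p - 1)) *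
        ENNReal.ofReal (p / (p - 1) * Q * (volume E).toReal ^ (1 - 1 / p)) := by
        gcongr
        · rw [← ENNReal.ofReal_rpow_of_pos hmpos, ENNReal.ofReal_toReal (measure_ne_top _ _)]
        · exact setLIntegral_le hp hQ h h0
    _ = ENNReal.ofReal (p / (p - 1) * Q) := by
        rw [← ENNReal.ofReal_mul (by positivity)]
        congr 1
        rw [mul_left_comm, ← Real.rpow_add hmpos]
        simp

lemma maxNorm_le_quasiNorm {p : ℝ} (hp : 1 < p) (f : L0) :
    maxNorm p f ≤ ENNReal.ofReal (p / (p - 1)) * quasiNorm p f := by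
  have hp1 : 0 < p - 1 := by linarith
  have hc : 0 < p / (p - 1) := by positivity
  rcases eq_or_ne (quasiNorm p f) ⊤ with h | h
  · rw [h, ENNReal.mul_top (by simpa using hc)]
    exact le_top
  have key : ∀ Q : ℝ, (quasiNorm p f).toReal < Q → maxNorm p f ≤ ENNReal.ofReal (p / (p - 1) * Q) :=
    fun Q hQ => maxNorm_le_of_quasiNorm_le hp (ENNReal.toReal_nonneg.trans_lt hQ)
      (by rw [← ENNReal.ofReal_toReal h]; exact ENNReal.ofReal_le_ofReal hQ.le)
  rw [← ENNReal.ofReal_toReal h, ← ENNReal.ofReal_mul hc.le]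
  have hcont : Tendsto (fun Q : ℝ => ENNReal.ofReal (p / (p - 1) * Q))
      (𝓝[>] (quasiNorm p f).toReal)
      (𝓝 (ENNReal.ofReal (p / (p - 1) * (quasiNorm p f).toReal))) := by
    refine Tendsto.mono_left ?_ nhdsWithin_le_nhds
    exact (ENNReal.continuous_ofReal.comp (continuous_const.mul continuous_id)).tendsto _
  refine ge_of_tendsto hcont ?_
  filter_upwards [self_mem_nhdsWithin] with Q hQ using key Q hQ

lemma quasiNorm_lt_top_iff {p : ℝ} (hp : 1 < p) (f : L0) :
    quasiNorm p f < ⊤ ↔ maxNorm p f < ⊤ :=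
  ⟨fun h => (maxNorm_le_quasiNorm hp f).trans_lt (ENNReal.mul_lt_top ENNReal.ofReal_lt_top h),
    fun h => (quasiNorm_le_maxNorm hp f).trans_lt h⟩

/-- The Lorentz space `L_{p,∞}[0,1]`, `1 < p < ∞`: all `f` with `‖f‖_{p,∞} < ∞`. -/
noncomputable def weakLp (p : ℝ) [hp : Fact (1 < p)] : Submodule ℝ L0 where
  carrier := {f | quasiNorm p f < ⊤}
  zero_mem' := by
    rw [mem_ofPred_eq, quasiNorm_lt_top_iff hp.out, maxNorm_zero]
    exact ENNReal.zero_lt_top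
  add_mem' := by
    intro f g hf hg
    rw [mem_ofPred_eq, quasiNorm_lt_top_iff hp.out] at *
    exact (maxNorm_add p f g).trans_lt (ENNReal.add_lt_top.2 ⟨hf, hg⟩)
  smul_mem' := by
    intro c f hf
    rw [mem_ofPred_eq, quasiNorm_lt_top_iff hp.out] at *
    rw [maxNorm_smul]
    exact ENNReal.mul_lt_top enorm_lt_top hf

variable {p : ℝ} [hp : Fact (1 < p)]

lemma mem_weakLp_iff {f : L0} : f ∈ weakLp p ↔ maxNorm p f < ⊤ :=
  quasiNorm_lt_top_iff hp.out f

lemma maxNorm_ne_top (f : weakLp p) : maxNorm p (f : L0) ≠ ⊤ :=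
  (mem_weakLp_iff.1 f.2).ne

lemma abs_sup_le_abs_add (f g : L0) : |f ⊔ g| ≤ |(|f| + |g|)| := by
  rw [← AEEqFun.coeFn_le]
  filter_upwards [AEEqFun.coeFn_abs (f ⊔ g), AEEqFun.coeFn_sup f g, AEEqFun.coeFn_abs f,
    AEEqFun.coeFn_abs g, AEEqFun.coeFn_add |f| |g|, AEEqFun.coeFn_abs (|f| + |g|)]
    with x h1 h2 h3 h4 h5 h6
  rw [h1, h2, h6, h5, Pi.add_apply, h3, h4]
  have := abs_max_le_max_abs_abs (a := f x) (b := g x)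
  refine (this.trans ?_).trans (le_abs_self _)
  exact max_le_add_of_nonneg (abs_nonneg _) (abs_nonneg _)

lemma abs_inf_le_abs_add (f g : L0) : |f ⊓ g| ≤ |(|f| + |g|)| := by
  rw [← AEEqFun.coeFn_le]
  filter_upwards [AEEqFun.coeFn_abs (f ⊓ g), AEEqFun.coeFn_inf f g, AEEqFun.coeFn_abs f,
    AEEqFun.coeFn_abs g, AEEqFun.coeFn_add |f| |g|, AEEqFun.coeFn_abs (|f| + |g|)]
    with x h1 h2 h3 h4 h5 h6
  rw [h1, h2, h6, h5, Pi.add_apply, h3, h4]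
  have := abs_min_le_max_abs_abs (a := f x) (b := g x)
  refine (this.trans ?_).trans (le_abs_self _)
  exact max_le_add_of_nonneg (abs_nonneg _) (abs_nonneg _)

lemma mem_weakLp_of_abs_le {f g : L0} (h : |f| ≤ |g|) (hg : g ∈ weakLp p) : f ∈ weakLp p :=
  mem_weakLp_iff.2 ((maxNorm_mono h).trans_lt (mem_weakLp_iff.1 hg))

lemma abs_abs_L0 (f : L0) : |(|f|)| ≤ |f| := by
  rw [← AEEqFun.coeFn_le]
  filter_upwards [AEEqFun.coeFn_abs f, AEEqFun.coeFn_abs |f|] with x h1 h2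
  rw [h2, h1, abs_abs]

lemma abs_add_abs_mem {f g : L0} (hf : f ∈ weakLp p) (hg : g ∈ weakLp p) :
    |f| + |g| ∈ weakLp p :=
  add_mem (mem_weakLp_of_abs_le (abs_abs_L0 f) hf) (mem_weakLp_of_abs_le (abs_abs_L0 g) hg)

/-- The pointwise a.e. lattice operations. -/
noncomputable instance instLattice : Lattice (weakLp p) :=
  Subtype.lattice
    (fun f g hf hg => mem_weakLp_of_abs_le (abs_sup_le_abs_add f g) (abs_add_abs_mem hf hg))
    (fun f g hf hg => mem_weakLp_of_abs_le (abs_inf_le_abs_add f g) (abs_add_abs_mem hf hg))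

noncomputable instance instNorm : Norm (weakLp p) := ⟨fun f => (maxNorm p (f : L0)).toReal⟩

lemma norm_def (f : weakLp p) : ‖f‖ = (maxNorm p (f : L0)).toReal := rfl

lemma normCore : NormedSpace.Core ℝ (weakLp p) where
  norm_nonneg _ := ENNReal.toReal_nonneg
  norm_smul c f := by
    rw [norm_def, norm_def, Submodule.coe_smul, maxNorm_smul, ENNReal.toReal_mul, toReal_enorm]
  norm_triangle f g := by
    rw [norm_def, norm_def, norm_def,
      ← ENNReal.toReal_add (maxNorm_ne_top f) (maxNorm_ne_top g)]
    exact ENNReal.toReal_mono (ENNReal.add_ne_top.2 ⟨maxNorm_ne_top f, maxNorm_ne_top g⟩)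
      (maxNorm_add p _ _)
  norm_eq_zero_iff f := by
    constructor
    · intro h
      have := ((ENNReal.toReal_eq_zero_iff _).1 h).resolve_right (maxNorm_ne_top f)
      exact Subtype.ext (maxNorm_eq_zero this)
    · rintro rfl
      rw [norm_def, Submodule.coe_zero, maxNorm_zero, ENNReal.toReal_zero]

noncomputable instance instNormedAddCommGroup : NormedAddCommGroup (weakLp p) :=
  NormedAddCommGroup.ofCore normCore

noncomputable instance instNormedSpace : NormedSpace ℝ (weakLp p) :=
  NormedSpace.ofCore normCore

lemma ofReal_norm_weakLp (f : weakLp p) : ENNReal.ofReal ‖f‖ = maxNorm p (f : L0) :=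
  ENNReal.ofReal_toReal (maxNorm_ne_top f)

instance instIsOrderedAddMonoid : IsOrderedAddMonoid (weakLp p) where
  add_le_add_left f g h k := by
    change (f : L0) + k ≤ (g : L0) + k
    have h' : (f : L0) ≤ g := h
    rw [← AEEqFun.coeFn_le] at h' ⊢
    filter_upwards [h', AEEqFun.coeFn_add (f : L0) k, AEEqFun.coeFn_add (g : L0) k] with x h1 h2 h3
    rw [h2, h3, Pi.add_apply, Pi.add_apply]
    exact add_le_add_left h1 _

instance instPosSMulMono : PosSMulMono ℝ (weakLp p) where
  smul_le_smul_of_nonneg_left c hc f g h := by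
    change c • (f : L0) ≤ c • (g : L0)
    have h' : (f : L0) ≤ g := h
    rw [← AEEqFun.coeFn_le] at h' ⊢
    filter_upwards [h', AEEqFun.coeFn_smul c (f : L0), AEEqFun.coeFn_smul c (g : L0)]
      with x h1 h2 h3
    rw [h2, h3, Pi.smul_apply, Pi.smul_apply]
    exact smul_le_smul_of_nonneg_left h1 hc

instance instHasSolidNorm : HasSolidNorm (weakLp p) where
  solid _ g h := ENNReal.toReal_mono (maxNorm_ne_top g) (maxNorm_mono h)

/-- The inclusion into `L¹`, used for completeness. -/
noncomputable def toL1 (f : weakLp p) : Lp ℝ 1 (volume : Measure I) :=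
  ⟨f, by
    rw [Lp.mem_Lp_iff_eLpNorm_lt_top, eLpNorm_one_eq_lintegral_enorm]
    exact (lintegral_le_maxNorm p _).trans_lt (mem_weakLp_iff.1 f.2)⟩

lemma enorm_L1 (f : Lp ℝ 1 (volume : Measure I)) : ‖f‖ₑ = ∫⁻ x, ‖(f : L0) x‖ₑ := by
  rw [Lp.enorm_def, eLpNorm_one_eq_lintegral_enorm]

instance instCompleteSpace : CompleteSpace (weakLp p) := by
  refine Metric.complete_of_cauchySeq_tendsto fun u hu => ?_
  have hcau : CauchySeq fun n => toL1 (u n) := by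
    rw [Metric.cauchySeq_iff] at hu ⊢
    intro ε hε
    obtain ⟨N, hN⟩ := hu ε hε
    refine ⟨N, fun m hm n hn => lt_of_le_of_lt ?_ (hN m hm n hn)⟩
    rw [dist_eq_norm, dist_eq_norm, norm_def, ← toReal_enorm]
    refine ENNReal.toReal_mono (maxNorm_ne_top _) ?_
    rw [enorm_L1]
    exact lintegral_le_maxNorm p _
  obtain ⟨g, hg⟩ := cauchySeq_tendsto_of_complete hcau
  have hg' : Tendsto (fun m => ∫⁻ x, ‖((u m : L0) - (g : L0)) x‖ₑ) atTop (𝓝 0) := by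
    rw [tendsto_iff_edist_tendsto_0] at hg
    refine hg.congr fun m => ?_
    rw [edist_eq_enorm_sub, enorm_L1]
    rfl
  have key : ∀ ε > (0 : ℝ), ∃ N, ∀ n ≥ N, maxNorm p ((u n : L0) - g) ≤ ENNReal.ofReal ε := by
    intro ε hε
    obtain ⟨N, hN⟩ := Metric.cauchySeq_iff.1 hu ε hε
    refine ⟨N, fun n hn => iSup₂_le fun E hE => ?_⟩
    rcases eq_or_ne (volume E) 0 with h0 | h0
    · rw [setLIntegral_measure_zero _ _ h0, mul_zero]
      exact bot_le
    have hfin : volume E ^ (1 / p - 1) ≠ ⊤ := by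
      rw [Ne, ENNReal.rpow_eq_top_iff]
      simp [h0]
    have hlim : Tendsto (fun m => ENNReal.ofReal ε + volume E ^ (1 / p - 1) *
        ∫⁻ x, ‖((u m : L0) - (g : L0)) x‖ₑ) atTop (𝓝 (ENNReal.ofReal ε)) := by
      have h1 := ENNReal.Tendsto.const_mul (a := volume E ^ (1 / p - 1)) hg' (Or.inr hfin)
      have h2 := (tendsto_const_nhds (x := ENNReal.ofReal ε) (f := atTop (α := ℕ))).add h1
      simpa using h2
    refine ge_of_tendsto hlim ?_
    filter_upwards [eventually_ge_atTop N] with m hm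
    have hnm : maxNorm p ((u n : L0) - u m) ≤ ENNReal.ofReal ε := by
      have h1 := (hN n hn m hm).le
      rw [dist_eq_norm] at h1
      have h2 := ENNReal.ofReal_le_ofReal h1
      rwa [ofReal_norm_weakLp] at h2
    calc volume E ^ (1 / p - 1) * ∫⁻ x in E, ‖((u n : L0) - (g : L0)) x‖ₑ
        ≤ volume E ^ (1 / p - 1) * ((∫⁻ x in E, ‖((u n : L0) - (u m : L0)) x‖ₑ)
          + ∫⁻ x in E, ‖((u m : L0) - (g : L0)) x‖ₑ) := by
          gcongr 1
          rw [← lintegral_add_left'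
            ((u n : L0) - (u m : L0)).aestronglyMeasurable.enorm.restrict]
          refine lintegral_mono_ae (ae_restrict_of_ae ?_)
          filter_upwards [AEEqFun.coeFn_sub (u n : L0) (u m : L0),
            AEEqFun.coeFn_sub (u m : L0) (g : L0), AEEqFun.coeFn_sub (u n : L0) (g : L0)]
            with x h1 h2 h3
          rw [h1, h2, h3, Pi.sub_apply, Pi.sub_apply, Pi.sub_apply, ← sub_add_sub_cancel _ ((u m : L0) x)]
          exact enorm_add_le _ _
      _ = volume E ^ (1 / p - 1) * (∫⁻ x in E, ‖((u n : L0) - (u m : L0)) x‖ₑ)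
          + volume E ^ (1 / p - 1) * (∫⁻ x in E, ‖((u m : L0) - (g : L0)) x‖ₑ) := mul_add _ _ _
      _ ≤ _ := by
          gcongr
          · exact (le_maxNorm p _ hE).trans hnm
          · exact Measure.restrict_le_self
  have hgmem : (g : L0) ∈ weakLp p := by
    obtain ⟨N, hN⟩ := key 1 one_pos
    have h1 : (u N : L0) - g ∈ weakLp p :=
      mem_weakLp_iff.2 ((hN N le_rfl).trans_lt ENNReal.ofReal_lt_top)
    simpa using sub_mem (u N).2 h1
  refine ⟨⟨g, hgmem⟩, ?_⟩
  rw [Metric.tendsto_atTop]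
  intro ε hε
  obtain ⟨N, hN⟩ := key (ε / 2) (by positivity)
  refine ⟨N, fun n hn => lt_of_le_of_lt ?_ (half_lt_self hε)⟩
  rw [dist_eq_norm, norm_def]
  exact ENNReal.toReal_le_of_le_ofReal (by positivity) (hN n hn)

instance instIsBanachLattice : IsBanachLattice (weakLp p) where
  smul_le_smul_of_nonneg_right _ hf c d hcd := by
    have h := smul_le_smul_of_nonneg_left hf (sub_nonneg.2 hcd)
    rw [smul_zero, sub_smul] at h
    exact sub_nonneg.1 h

/-- The (class of the) characteristic function `χ_{[0,1]}`. -/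
noncomputable def chi (p : ℝ) [hp : Fact (1 < p)] : weakLp p :=
  ⟨AEEqFun.const I (1 : ℝ), by
    change quasiNorm p _ < ⊤
    refine lt_of_le_of_lt (iSup₂_le fun t ht => ?_) ENNReal.one_lt_top
    have hp0 : 0 < p := by linarith [hp.out]
    rcases lt_or_ge t 1 with h | h
    · refine mul_le_one' (by simpa using h.le) (ENNReal.rpow_le_one prob_le_one (by positivity))
    · have : {x : I | t < |(AEEqFun.const I (1 : ℝ) : L0) x|} = ∅ := by
        ext x
        simpa using h
      rw [this, measure_empty, ENNReal.zero_rpow_of_pos (by positivity), mul_zero]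
      exact bot_le⟩

end Lorentz

/-!
The equivalence of the norms is `quasiNorm_le_maxNorm` and `maxNorm_le_quasiNorm`. Since
`f = sup_n f ⊓ n χ` for `f ≥ 0`, the single point `χ_{[0,1]}` generates `L_{p,∞}[0,1]` as a band.
A quasi-interior point `u` would make `{u}` a weakly compact set generating the space as a closed
ideal, so the absence of such points follows from the failure of IWCG, the heart of the matter.

For a point `x` of `[0,1]` consider the averages `λ(B)^{1/p - 1} ∫_B |f| dλ` over balls `B` of
radius `r` around `x`, bounded by `‖f‖`. The functions for which they tend to `0`, as `r → 0` along
a fixed free ultrafilter, form a closed ideal `regularAt p x`; it is proper, since it does not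
contain `y ↦ |y - x|^{-1/p}`. A given `f` lies in `regularAt p x` for all but countably many `x`
(`countable_setOf_notMem_regularAt`): if the averages were at least `δ` at `N` points, then, at a
common small radius `r`, the integral of `|f|` over `N` disjoint balls would be at least
`N δ r^{1 - 1/p}`, but it is at most `‖f‖ (2 N r)^{1 - 1/p}`, which bounds `N`.

A weakly compact set `K` injects weakly continuously into the separable space `L¹`, and is therefore
weakly separable. Closed subspaces being weakly closed, `regularAt p x` contains `K` as soon as it
contains a fixed countable subset of `K`
(`exists_countable_subset_of_isCompact_toWeakSpace_image`). This happens for all but countably many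
`x`, so `K` lies in a proper closed ideal.
-/

/-! ### Generalities on weakly compact sets and Banach lattices -/

/-- A weakly compact subset of a space that injects continuously into a separable one is weakly
separable, in the following form: a closed subspace contains it as soon as it contains a suitable
countable subset. Closed subspaces are weakly closed, so `T '' (K ∩ Y)` is weakly compact, hence
closed. -/
theorem exists_countable_subset_of_isCompact_toWeakSpace_image
    {E F : Type*} [NormedAddCommGroup E] [NormedSpace ℝ E] [NormedAddCommGroup F]
    [NormedSpace ℝ F] [SecondCountableTopology F] {T : E →L[ℝ] F} (hT : Function.Injective T)
    {K : Set E} (hK : IsCompact (toWeakSpace ℝ E '' K)) :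
    ∃ D : Set E, D.Countable ∧ D ⊆ K ∧
      ∀ Y : Submodule ℝ E, IsClosed (Y : Set E) → D ⊆ Y → K ⊆ Y := by
  obtain ⟨t, htK, htc, hKt⟩ :=
    (TopologicalSpace.IsSeparable.of_separableSpace (T '' K)).exists_countable_dense_subset
  refine ⟨K ∩ T ⁻¹' t, (htc.preimage hT).mono inter_subset_right, inter_subset_left,
    fun Y hY hDY k hk => ?_⟩
  have hYw : IsClosed (toWeakSpace ℝ E '' (Y : Set E)) := by
    have h := Y.convex.toWeakSpace_closure ℝ
    rw [hY.closure_eq] at h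
    rw [h]
    exact isClosed_closure
  have hcomp := ((hK.inter_right hYw).image (WeakSpace.map T).continuous).isClosed
  have hcl := hcomp.preimage (toWeakSpaceCLM ℝ F).continuous
  have hsub : t ⊆ toWeakSpaceCLM ℝ F ⁻¹'
      (WeakSpace.map T '' (toWeakSpace ℝ E '' K ∩ toWeakSpace ℝ E '' (Y : Set E))) := by
    intro y hy
    obtain ⟨d, hd, rfl⟩ := htK hy
    exact ⟨toWeakSpace ℝ E d, ⟨⟨d, hd, rfl⟩, d, hDY ⟨hd, hy⟩, rfl⟩, rfl⟩
  obtain ⟨z, ⟨-, y, hy, rfl⟩, hz⟩ := hcl.closure_subset_iff.2 hsub (hKt ⟨k, hk, rfl⟩)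
  have hyk : y = k := hT hz
  exact hyk ▸ hy

lemma isWeaklyCompact_singleton {X : Type*} [NormedAddCommGroup X]
    [NormedSpace ℝ X] (u : X) : IsWeaklyCompact {u} := by
  rw [IsWeaklyCompact, image_singleton]
  exact isCompact_singleton

section BanachLattice

variable {X : Type*} [NormedAddCommGroup X] [NormedSpace ℝ X] [Lattice X] [IsBanachLattice X]

lemma IsClosedIdeal.mem_of_abs_mem {Y : Submodule ℝ X} (hY : IsClosedIdeal Y) {x : X}
    (h : |x| ∈ Y) : x ∈ Y :=
  hY.solid (abs_abs x).ge h

/-- A closed ideal containing `u ≥ 0` contains the truncations `x ⊓ n u`. -/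
lemma IsClosedIdeal.inf_smul_mem {Y : Submodule ℝ X} (hY : IsClosedIdeal Y) {u x : X}
    (hu : 0 ≤ u) (huY : u ∈ Y) (hx : 0 ≤ x) (n : ℕ) : x ⊓ (n : ℝ) • u ∈ Y := by
  have hnu : 0 ≤ (n : ℝ) • u := smul_nonneg n.cast_nonneg hu
  refine hY.solid ?_ (Y.smul_mem (n : ℝ) huY)
  rw [abs_of_nonneg hnu, abs_of_nonneg (le_inf hx hnu)]
  exact inf_le_right

lemma IsQuasiInteriorPoint.idealGenerated_eq_top {u : X} (hu : IsQuasiInteriorPoint u) :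
    idealGenerated {u} = ⊤ := by
  refine eq_top_iff.2 fun x _ => ?_
  refine Submodule.mem_sInf.2 fun Y ⟨hY, huY⟩ => hY.mem_of_abs_mem ?_
  have hlim := hu.2 |x| (abs_nonneg x)
  simp_rw [norm_sub_rev |x|] at hlim
  exact hY.isClosed.mem_of_tendsto (tendsto_iff_norm_sub_tendsto_zero.2 hlim)
    (Eventually.of_forall fun n => hY.inf_smul_mem hu.1 (huY rfl) (abs_nonneg x) n)

lemma IsQuasiInteriorPoint.isIWCG {u : X} (hu : IsQuasiInteriorPoint u) : IsIWCG X :=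
  ⟨{u}, isWeaklyCompact_singleton u, hu.idealGenerated_eq_top⟩

end BanachLattice

namespace Lorentz

/-! ### The unit of `L_{p,∞}[0,1]` -/

section Unit

variable {p : ℝ} [hp : Fact (1 < p)]

lemma coeFn_chi : (chi p : L0) =ᵐ[volume] fun _ => 1 :=
  AEEqFun.coeFn_const I (1 : ℝ)

lemma chi_nonneg : 0 ≤ chi p := by
  change (0 : L0) ≤ (chi p : L0)
  rw [← AEEqFun.coeFn_le]
  filter_upwards [coeFn_chi (p := p), AEEqFun.coeFn_zero (α := I) (μ := volume) (β := ℝ)]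
    with x h1 h2
  rw [h1, h2]
  exact zero_le_one

lemma isWeakOrderUnit_chi : IsWeakOrderUnit (chi p) := by
  refine ⟨chi_nonneg, fun f hf => Subtype.ext (AEEqFun.ext ?_)⟩
  have hchi : |chi p| = chi p := abs_of_nonneg chi_nonneg
  rw [hchi] at hf
  have hf' : |(f : L0)| ⊓ (chi p : L0) = 0 := congrArg Subtype.val hf
  have h0 := AEEqFun.coeFn_inf |(f : L0)| (chi p : L0)
  rw [hf'] at h0
  filter_upwards [h0, coeFn_chi (p := p), AEEqFun.coeFn_abs (f : L0),
    AEEqFun.coeFn_zero (α := I) (μ := volume) (β := ℝ)] with x h1 h2 h3 h4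
  rw [h2, h3, h4] at h1
  rw [Submodule.coe_zero, h4]
  rcases min_choice |(f : L0) x| 1 with h | h
  · exact abs_eq_zero.1 (h.symm.trans h1.symm)
  · exact absurd (h.symm.trans h1.symm) one_ne_zero

lemma isLUB_inf_smul_chi (f : weakLp p) :
    IsLUB (range fun n : ℕ => f ⊓ (n : ℝ) • chi p) f := by
  refine ⟨?_, fun g hg => ?_⟩
  · rintro _ ⟨n, rfl⟩
    exact inf_le_left
  change (f : L0) ≤ (g : L0)
  have hg' : ∀ n : ℕ, (f : L0) ⊓ ((n : ℝ) • chi p : weakLp p) ≤ (g : L0) :=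
    fun n => hg (mem_range_self n)
  have hae : ∀ n : ℕ, ∀ᵐ x, min ((f : L0) x) n ≤ (g : L0) x := by
    intro n
    filter_upwards [AEEqFun.coeFn_le.2 (hg' n), coeFn_chi (p := p),
      AEEqFun.coeFn_inf (f : L0) (((n : ℝ) • chi p : weakLp p) : L0),
      AEEqFun.coeFn_smul (n : ℝ) (chi p : L0)] with x h1 h2 h3 h4
    rw [h3, Submodule.coe_smul, h4, Pi.smul_apply, h2, smul_eq_mul, mul_one] at h1
    exact h1
  rw [← AEEqFun.coeFn_le]
  filter_upwards [ae_all_iff.2 hae] with x hx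
  obtain ⟨n, hn⟩ := exists_nat_ge ((f : L0) x)
  simpa [min_eq_left hn] using hx n

lemma isBWCG_weakLp : IsBWCG (weakLp p) := by
  refine ⟨{chi p}, isWeaklyCompact_singleton _, eq_top_iff.2 fun f _ => ?_⟩
  refine Submodule.mem_sInf.2 fun Z ⟨hZ, hchi⟩ => hZ.mem_of_abs_mem ?_
  refine hZ.isLUB_mem ?_ (isLUB_inf_smul_chi |f|)
  rintro _ ⟨n, rfl⟩
  exact hZ.inf_smul_mem chi_nonneg (hchi rfl) (abs_nonneg f) n

/-- The inclusion of `L_{p,∞}[0,1]` into `L¹[0,1]` as a bounded operator. -/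
noncomputable def toL1CLM (p : ℝ) [hp : Fact (1 < p)] :
    weakLp p →L[ℝ] Lp ℝ 1 (volume : Measure I) :=
  LinearMap.mkContinuous
    { toFun := toL1
      map_add' := fun _ _ => rfl
      map_smul' := fun _ _ => rfl } 1 fun f => by
    rw [one_mul, norm_def, ← toReal_enorm]
    refine ENNReal.toReal_mono (maxNorm_ne_top f) ?_
    rw [enorm_L1]
    exact lintegral_le_maxNorm p _

lemma toL1CLM_injective : Function.Injective (toL1CLM p) := fun _ _ h =>
  Subtype.ext (congrArg (fun k : Lp ℝ 1 (volume : Measure I) => (k : L0)) h)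

end Unit

/-! ### Local averages -/

section Average

/-- The weighted average `λ(E)^{1/p - 1} ∫_E |f| dλ` occurring in `maxNorm`. -/
noncomputable def average (p : ℝ) (E : Set I) (f : L0) : ℝ≥0∞ :=
  volume E ^ (1 / p - 1) * ∫⁻ x in E, ‖f x‖ₑ

lemma average_mono {p : ℝ} {E : Set I} {f g : L0} (h : |f| ≤ |g|) :
    average p E f ≤ average p E g := by
  unfold average
  gcongr 1
  refine lintegral_mono_ae (ae_restrict_of_ae ?_)
  filter_upwards [AEEqFun.coeFn_le.2 h, AEEqFun.coeFn_abs f, AEEqFun.coeFn_abs g] with x hx hf hg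
  rw [hf, hg] at hx
  rw [Real.enorm_eq_ofReal_abs, Real.enorm_eq_ofReal_abs]
  exact ENNReal.ofReal_le_ofReal hx

lemma average_add_le (p : ℝ) (E : Set I) (f g : L0) :
    average p E (f + g) ≤ average p E f + average p E g := by
  unfold average
  rw [← mul_add, ← lintegral_add_left' f.aestronglyMeasurable.enorm.restrict]
  gcongr 1
  refine lintegral_mono_ae (ae_restrict_of_ae ?_)
  filter_upwards [AEEqFun.coeFn_add f g] with x hx
  rw [hx]
  exact enorm_add_le _ _

lemma average_smul (p : ℝ) (E : Set I) (c : ℝ) (f : L0) :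
    average p E (c • f) = ‖c‖ₑ * average p E f := by
  unfold average
  rw [mul_left_comm, ← lintegral_const_mul' _ _ enorm_ne_top]
  congr 1
  refine lintegral_congr_ae (ae_restrict_of_ae ?_)
  filter_upwards [AEEqFun.coeFn_smul c f] with x hx
  rw [hx, Pi.smul_apply, enorm_smul]

lemma average_zero (p : ℝ) (E : Set I) : average p E (0 : L0) = 0 := by
  simpa using average_smul p E 0 (0 : L0)

lemma volume_closedBall_le (x : I) (r : ℝ) :
    volume (Metric.closedBall x r) ≤ ENNReal.ofReal (2 * r) := by
  rw [unitInterval.volume_apply, ← Real.volume_closedBall (x : ℝ) r]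
  refine measure_mono ?_
  rintro _ ⟨y, hy, rfl⟩
  exact hy

lemma le_volume_closedBall (x : I) {r : ℝ} (hr : r ≤ 1 / 2) :
    ENNReal.ofReal r ≤ volume (Metric.closedBall x r) := by
  rw [unitInterval.volume_apply]
  have hx0 := x.2.1
  have hx1 := x.2.2
  -- One of the two halves of the ball lies in `[0,1]`, because `r ≤ 1/2`.
  rcases le_total (x : ℝ) (1 / 2) with h | h
  · have hsub : Icc (x : ℝ) (x + r) ⊆ Subtype.val '' Metric.closedBall x r := fun y hy =>
      ⟨⟨y, by linarith [hy.1], by linarith [hy.2]⟩, by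
        rw [Metric.mem_closedBall, Subtype.dist_eq, Real.dist_eq, abs_le]
        constructor <;> linarith [hy.1, hy.2], rfl⟩
    have hle := measure_mono (μ := volume) hsub
    rwa [Real.volume_Icc, add_sub_cancel_left] at hle
  · have hsub : Icc ((x : ℝ) - r) x ⊆ Subtype.val '' Metric.closedBall x r := fun y hy =>
      ⟨⟨y, by linarith [hy.1], by linarith [hy.2]⟩, by
        rw [Metric.mem_closedBall, Subtype.dist_eq, Real.dist_eq, abs_le]
        constructor <;> linarith [hy.1, hy.2], rfl⟩
    have hle := measure_mono (μ := volume) hsub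
    rwa [Real.volume_Icc, sub_sub_cancel] at hle

/-- The number of disjoint balls of a common radius on which `f` has averages at least `δ` is
bounded in terms of `f` and `δ`: the union of the balls has measure at most `2 N r`, while the
integral of `|f|` over it is at least `N δ r^{1 - 1/p}`. -/
lemma card_rpow_mul_le {p : ℝ} [hp : Fact (1 < p)] (f : weakLp p) {δ r : ℝ} (hδ : 0 < δ)
    (hr : 0 < r) (hr' : r ≤ 1 / 2) (s : Finset I)
    (hs : (s : Set I).PairwiseDisjoint fun x => Metric.closedBall x r)
    (hf : ∀ x ∈ s, ENNReal.ofReal δ ≤ average p (Metric.closedBall x r) f) :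
    (s.card : ℝ) ^ (1 / p) * δ ≤ 2 ^ (1 - 1 / p) * ‖f‖ := by
  have hp1 := hp.out
  have hp0 : 0 < p := by linarith
  have hq : 0 < 1 - 1 / p := by
    rw [sub_pos, div_lt_one hp0]
    exact hp1
  rcases s.eq_empty_or_nonempty with rfl | hne
  · rw [Finset.card_empty, Nat.cast_zero, Real.zero_rpow (by positivity), zero_mul]
    positivity
  have hN : 0 < (s.card : ℝ) := by exact_mod_cast hne.card_pos
  set E : Set I := ⋃ x ∈ s, Metric.closedBall x r with hE
  have hEm : MeasurableSet E :=
    Finset.measurableSet_biUnion _ fun x _ => Metric.isClosed_closedBall.measurableSet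
  have hball0 : ∀ x : I, volume (Metric.closedBall x r) ≠ 0 := fun x h => by
    have := le_volume_closedBall x hr'
    rw [h, nonpos_iff_eq_zero, ENNReal.ofReal_eq_zero] at this
    linarith
  have hcancel : ∀ A : Set I, volume A ≠ 0 →
      volume A ^ (1 - 1 / p) * volume A ^ (1 / p - 1) = 1 := fun A hA => by
    rw [← ENNReal.rpow_add _ _ hA (measure_ne_top _ _), sub_add_sub_cancel, sub_self,
      ENNReal.rpow_zero]
  have hlow : ∀ x ∈ s, ENNReal.ofReal (δ * r ^ (1 - 1 / p)) ≤
      ∫⁻ y in Metric.closedBall x r, ‖(f : L0) y‖ₑ := by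
    intro x hx
    calc ENNReal.ofReal (δ * r ^ (1 - 1 / p))
        = ENNReal.ofReal r ^ (1 - 1 / p) * ENNReal.ofReal δ := by
          rw [ENNReal.ofReal_mul hδ.le, ENNReal.ofReal_rpow_of_pos hr, mul_comm]
      _ ≤ volume (Metric.closedBall x r) ^ (1 - 1 / p) *
            average p (Metric.closedBall x r) f := by
          gcongr
          · exact le_volume_closedBall x hr'
          · exact hf x hx
      _ = _ := by rw [average, ← mul_assoc, hcancel _ (hball0 x), one_mul]
  have hup : volume E ≤ ENNReal.ofReal (s.card * (2 * r)) := by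
    refine (measure_biUnion_finset_le _ _).trans ?_
    refine (Finset.sum_le_sum fun x _ => volume_closedBall_le x r).trans ?_
    rw [Finset.sum_const, nsmul_eq_mul, ENNReal.ofReal_mul hN.le, ENNReal.ofReal_natCast]
  have hE0 : volume E ≠ 0 := by
    obtain ⟨x, hx⟩ := hne
    exact fun h => hball0 x (measure_mono_null (subset_biUnion_of_mem (u := fun x =>
      Metric.closedBall x r) hx) h)
  have hmain : ENNReal.ofReal (s.card * (δ * r ^ (1 - 1 / p))) ≤
      ENNReal.ofReal ((s.card * (2 * r)) ^ (1 - 1 / p) * ‖f‖) := by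
    calc ENNReal.ofReal (s.card * (δ * r ^ (1 - 1 / p)))
        = ∑ _x ∈ s, ENNReal.ofReal (δ * r ^ (1 - 1 / p)) := by
          rw [Finset.sum_const, nsmul_eq_mul, ENNReal.ofReal_mul hN.le, ENNReal.ofReal_natCast]
      _ ≤ ∑ x ∈ s, ∫⁻ y in Metric.closedBall x r, ‖(f : L0) y‖ₑ := Finset.sum_le_sum hlow
      _ = ∫⁻ y in E, ‖(f : L0) y‖ₑ :=
          (lintegral_biUnion_finset hs
            (fun x _ => Metric.isClosed_closedBall.measurableSet) _).symm
      _ = volume E ^ (1 - 1 / p) * (volume E ^ (1 / p - 1) * ∫⁻ y in E, ‖(f : L0) y‖ₑ) := by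
          rw [← mul_assoc, hcancel _ hE0, one_mul]
      _ ≤ ENNReal.ofReal (s.card * (2 * r)) ^ (1 - 1 / p) * maxNorm p f := by
          gcongr
          exact le_maxNorm p f hEm
      _ = _ := by
          rw [ENNReal.ofReal_rpow_of_pos (by positivity), ← ofReal_norm_weakLp,
            ENNReal.ofReal_mul (by positivity)]
  rw [ENNReal.ofReal_le_ofReal_iff (by positivity), Real.mul_rpow hN.le (by positivity),
    Real.mul_rpow zero_le_two hr.le] at hmain
  have hsplit : (s.card : ℝ) = (s.card : ℝ) ^ (1 - 1 / p) * (s.card : ℝ) ^ (1 / p) := by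
    rw [← Real.rpow_add hN, sub_add_cancel, Real.rpow_one]
  have hc : 0 < (s.card : ℝ) ^ (1 - 1 / p) * r ^ (1 - 1 / p) :=
    mul_pos (Real.rpow_pos_of_pos hN _) (Real.rpow_pos_of_pos hr _)
  refine le_of_mul_le_mul_left ?_ hc
  calc (s.card : ℝ) ^ (1 - 1 / p) * r ^ (1 - 1 / p) * ((s.card : ℝ) ^ (1 / p) * δ)
      = (s.card : ℝ) ^ (1 - 1 / p) * (s.card : ℝ) ^ (1 / p) * (δ * r ^ (1 - 1 / p)) := by ring
    _ = s.card * (δ * r ^ (1 - 1 / p)) := by rw [← hsplit]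
    _ ≤ _ := hmain
    _ = _ := by ring

end Average

/-! ### Functions with no singularity at a point -/

section Regular

variable {p : ℝ} [hp : Fact (1 < p)]

/-- The radii `1 / (n + 2)`; they are at most `1/2`, as in `le_volume_closedBall`. -/
noncomputable def radius (n : ℕ) : ℝ := 1 / (n + 2)

lemma radius_pos (n : ℕ) : 0 < radius n := by
  unfold radius
  positivity

lemma radius_le (n : ℕ) : radius n ≤ 1 / 2 := by
  unfold radius
  gcongr
  linarith [n.cast_nonneg (α := ℝ)]

lemma tendsto_radius : Tendsto radius atTop (𝓝 0) := by
  have h := (tendsto_one_div_add_atTop_nhds_zero_nat (𝕜 := ℝ)).comp (tendsto_add_atTop_nat 1)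
  refine h.congr fun n => ?_
  simp only [Function.comp_apply, radius]
  push_cast
  ring

/-- The ideal of all `f` whose averages over the balls around `x` tend to `0` along a fixed free
ultrafilter on the radii. With an ultrafilter, the averages of a function outside the ideal are
bounded below at almost all radii in the sense of
the ultrafilter, so that several points share such a radius. -/
noncomputable def regularAt (p : ℝ) [hp : Fact (1 < p)] (x : I) : Submodule ℝ (weakLp p) where
  carrier := {f | Tendsto (fun n => average p (Metric.closedBall x (radius n)) (f : L0))
    (hyperfilter ℕ) (𝓝 0)}
  zero_mem' := by
    simp only [mem_ofPred_eq, Submodule.coe_zero, average_zero]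
    exact tendsto_const_nhds
  add_mem' := fun {f g} hf hg => by
    have h := Tendsto.add hf hg
    rw [add_zero] at h
    exact tendsto_of_tendsto_of_tendsto_of_le_of_le tendsto_const_nhds h (fun _ => zero_le)
      fun _ => average_add_le _ _ _ _
  smul_mem' := fun c f hf => by
    have h := ENNReal.Tendsto.const_mul (a := ‖c‖ₑ) hf (Or.inr enorm_ne_top)
    rw [mul_zero] at h
    exact h.congr fun n => (average_smul _ _ _ _).symm

lemma mem_regularAt {x : I} {f : weakLp p} : f ∈ regularAt p x ↔
    Tendsto (fun n => average p (Metric.closedBall x (radius n)) (f : L0))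
      (hyperfilter ℕ) (𝓝 0) := Iff.rfl

lemma isClosedIdeal_regularAt (x : I) : IsClosedIdeal (regularAt p x) where
  isClosed := by
    refine isClosed_of_closure_subset fun f hf => ?_
    rw [SetLike.mem_coe, mem_regularAt, ENNReal.tendsto_nhds_zero]
    intro ε hε
    obtain ⟨δ, -, hδ, hδε⟩ := ENNReal.lt_iff_exists_real_btwn.1 hε
    rw [ENNReal.ofReal_pos] at hδ
    obtain ⟨g, hg, hfg⟩ := Metric.mem_closure_iff.1 hf (δ / 2) (by positivity)
    have hg' := ENNReal.tendsto_nhds_zero.1 (mem_regularAt.1 hg) (ENNReal.ofReal (δ / 2))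
      (by simpa using hδ)
    filter_upwards [hg'] with n hn
    have hsub : average p (Metric.closedBall x (radius n)) ((f - g : weakLp p) : L0) ≤
        ENNReal.ofReal (δ / 2) := by
      refine (le_maxNorm p _ Metric.isClosed_closedBall.measurableSet).trans ?_
      rw [← ofReal_norm_weakLp, ← dist_eq_norm]
      exact ENNReal.ofReal_le_ofReal hfg.le
    have hadd := average_add_le p (Metric.closedBall x (radius n)) ((f - g : weakLp p) : L0) g
    rw [← Submodule.coe_add, sub_add_cancel] at hadd
    refine (hadd.trans (add_le_add hsub hn)).trans ?_
    rw [← ENNReal.ofReal_add (by positivity) (by positivity), add_halves]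
    exact hδε.le
  solid := fun f g hfg hg => tendsto_of_tendsto_of_tendsto_of_le_of_le tendsto_const_nhds
    (mem_regularAt.1 hg) (fun _ => zero_le) fun _ => average_mono hfg

lemma finite_setOf_eventually_le_average (f : weakLp p) {δ : ℝ} (hδ : 0 < δ) :
    {x : I | ∀ᶠ n in (hyperfilter ℕ : Filter ℕ),
      ENNReal.ofReal δ ≤ average p (Metric.closedBall x (radius n)) (f : L0)}.Finite := by
  by_contra hinf
  have hp0 : 0 < p := by linarith [hp.out]
  obtain ⟨N, hN⟩ := (((tendsto_rpow_atTop (y := 1 / p) (by positivity)).comp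
    tendsto_natCast_atTop_atTop).eventually_gt_atTop (2 ^ (1 - 1 / p) * ‖f‖ / δ)).exists
  obtain ⟨s, hs, hcard⟩ := Set.Infinite.exists_subset_card_eq hinf N
  have hlarge : ∀ᶠ n in (hyperfilter ℕ : Filter ℕ), ∀ x ∈ s,
      ENNReal.ofReal δ ≤ average p (Metric.closedBall x (radius n)) (f : L0) :=
    (Finset.eventually_all s).2 fun x hx => hs hx
  have hdisj : ∀ᶠ n in (hyperfilter ℕ : Filter ℕ), ∀ x ∈ s, ∀ y ∈ s, x ≠ y →
      radius n + radius n < dist x y := by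
    refine (Finset.eventually_all s).2 fun x _ => (Finset.eventually_all s).2 fun y _ => ?_
    rcases eq_or_ne x y with rfl | hxy
    · exact Eventually.of_forall fun _ h => absurd rfl h
    have h2 := tendsto_radius.add tendsto_radius
    rw [add_zero] at h2
    have h3 := (h2.mono_left Nat.hyperfilter_le_atTop).eventually_lt_const (dist_pos.2 hxy)
    exact h3.mono fun _ h _ => h
  obtain ⟨n, hn, hn'⟩ := (hlarge.and hdisj).exists
  have hle := card_rpow_mul_le f hδ (radius_pos n) (radius_le n) s
    (fun x hx y hy hxy => Metric.closedBall_disjoint_closedBall (hn' x hx y hy hxy)) hn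
  rw [hcard, ← le_div_iff₀ hδ] at hle
  exact hN.not_ge hle

lemma countable_setOf_notMem_regularAt (f : weakLp p) : {x | f ∉ regularAt p x}.Countable := by
  refine Set.Countable.mono (fun x hx => ?_) (countable_iUnion fun m : ℕ =>
    (finite_setOf_eventually_le_average f (δ := 1 / ((m : ℝ) + 1)) (by positivity)).countable)
  rw [mem_ofPred_eq, mem_regularAt, ENNReal.tendsto_nhds_zero] at hx
  push Not at hx
  obtain ⟨ε, hε, h⟩ := hx
  obtain ⟨δ, -, hδ, hδε⟩ := ENNReal.lt_iff_exists_real_btwn.1 hε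
  obtain ⟨m, hm⟩ := exists_nat_one_div_lt (ENNReal.ofReal_pos.1 hδ)
  refine mem_iUnion.2 ⟨m, ?_⟩
  refine h.mono fun n hn => ?_
  exact ((ENNReal.ofReal_le_ofReal hm.le).trans hδε.le).trans hn.le

/-- The function `y ↦ |y - x|^{-1/p}`. -/
noncomputable def powerSingularity (p : ℝ) (x : I) : L0 :=
  AEEqFun.mk (fun y : I => dist y x ^ (-(1 / p)))
    (measurable_id.dist measurable_const |>.pow_const _).aestronglyMeasurable

lemma coeFn_powerSingularity (p : ℝ) (x : I) :
    powerSingularity p x =ᵐ[volume] fun y => dist y x ^ (-(1 / p)) :=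
  AEEqFun.coeFn_mk _ _

lemma powerSingularity_mem (x : I) : powerSingularity p x ∈ weakLp p := by
  have hp0 : 0 < p := by linarith [hp.out]
  refine lt_of_le_of_lt (b := ENNReal.ofReal (2 ^ (1 / p))) (iSup₂_le fun t ht => ?_)
    ENNReal.ofReal_lt_top
  have hvol : volume {y : I | t < |powerSingularity p x y|} ≤
      ENNReal.ofReal (2 * t ^ (-p)) := by
    refine (measure_mono_ae ?_).trans (volume_closedBall_le x _)
    filter_upwards [coeFn_powerSingularity p x] with y hy hty
    have hty' : t < |powerSingularity p x y| := hty
    rw [hy, abs_of_nonneg (Real.rpow_nonneg dist_nonneg _)] at hty'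
    by_contra hlt
    have hlt' : t ^ (-p) < dist y x := not_le.1 hlt
    refine hty'.not_ge ?_
    calc dist y x ^ (-(1 / p)) ≤ (t ^ (-p)) ^ (-(1 / p)) :=
          Real.rpow_le_rpow_of_nonpos (by positivity) hlt'.le (by simpa using hp0.le)
      _ = t := by
          rw [← Real.rpow_mul ht.le, neg_mul_neg, mul_one_div_cancel hp0.ne', Real.rpow_one]
  calc ENNReal.ofReal t * volume {y : I | t < |powerSingularity p x y|} ^ (1 / p)
      ≤ ENNReal.ofReal t * ENNReal.ofReal (2 * t ^ (-p)) ^ (1 / p) := by gcongr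
    _ = ENNReal.ofReal (2 ^ (1 / p)) := by
        rw [ENNReal.ofReal_rpow_of_pos (by positivity), ← ENNReal.ofReal_mul ht.le,
          Real.mul_rpow zero_le_two (by positivity), ← Real.rpow_mul ht.le, neg_mul,
          mul_one_div_cancel hp0.ne', Real.rpow_neg_one, mul_left_comm,
          mul_inv_cancel₀ ht.ne', mul_one]

lemma one_le_average_powerSingularity (x : I) {r : ℝ} (hr : 0 < r) (hr' : r ≤ 1 / 2) :
    1 ≤ average p (Metric.closedBall x r) (powerSingularity p x) := by
  have hp0 : 0 < p := by linarith [hp.out]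
  set B := Metric.closedBall x r
  have hrB : ENNReal.ofReal r ≤ volume B := le_volume_closedBall x hr'
  have hB0 : volume B ≠ 0 := ((ENNReal.ofReal_pos.2 hr).trans_le hrB).ne'
  have hint : ENNReal.ofReal (r ^ (-(1 / p))) * volume B ≤
      ∫⁻ y in B, ‖powerSingularity p x y‖ₑ := by
    rw [← setLIntegral_const]
    refine setLIntegral_mono_ae' Metric.isClosed_closedBall.measurableSet ?_
    -- The point `x` is excluded: there `dist y x ^ (-(1 / p))` has the value `0`.
    filter_upwards [coeFn_powerSingularity p x, Measure.ae_ne volume x] with y hy hyx hyB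
    rw [hy, Real.enorm_eq_ofReal_abs, abs_of_nonneg (Real.rpow_nonneg dist_nonneg _)]
    exact ENNReal.ofReal_le_ofReal
      (Real.rpow_le_rpow_of_nonpos (dist_pos.2 hyx) hyB (by simpa using hp0.le))
  calc (1 : ℝ≥0∞) = ENNReal.ofReal r ^ (1 / p) * ENNReal.ofReal (r ^ (-(1 / p))) := by
        rw [ENNReal.ofReal_rpow_of_pos hr, ← ENNReal.ofReal_mul (by positivity),
          ← Real.rpow_add hr, add_neg_cancel, Real.rpow_zero, ENNReal.ofReal_one]
    _ ≤ volume B ^ (1 / p) * ENNReal.ofReal (r ^ (-(1 / p))) := by gcongr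
    _ = volume B ^ (1 / p - 1) * (ENNReal.ofReal (r ^ (-(1 / p))) * volume B) := by
        rw [← sub_add_cancel (1 / p) 1, ENNReal.rpow_add _ _ hB0 (measure_ne_top _ _),
          ENNReal.rpow_one, sub_add_cancel]
        ring
    _ ≤ _ := by
        unfold average
        gcongr

lemma regularAt_ne_top (x : I) : regularAt p x ≠ ⊤ := by
  intro h
  have hmem : (⟨powerSingularity p x, powerSingularity_mem x⟩ : weakLp p) ∈ regularAt p x :=
    h ▸ Submodule.mem_top
  obtain ⟨n, hn⟩ := ((mem_regularAt.1 hmem).eventually_lt_const zero_lt_one).exists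
  exact hn.not_ge (one_le_average_powerSingularity x (radius_pos n) (radius_le n))

/-- A weakly compact set `K` is controlled by a countable subset `D`, and each element of `D` is
singular at countably many points only; so all of `K` is regular at some point. -/
theorem not_isIWCG_weakLp : ¬ IsIWCG (weakLp p) := by
  rintro ⟨K, hK, hKtop⟩
  have : Fact ((1 : ℝ≥0∞) ≠ ∞) := ⟨ENNReal.one_ne_top⟩
  obtain ⟨D, hDc, -, hD⟩ :=
    exists_countable_subset_of_isCompact_toWeakSpace_image (toL1CLM_injective (p := p)) hK
  have hcount : (⋃ f ∈ D, {x : I | f ∉ regularAt p x}).Countable :=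
    hDc.biUnion fun f _ => countable_setOf_notMem_regularAt f
  obtain ⟨x, hx⟩ : ∃ x : I, x ∉ ⋃ f ∈ D, {x : I | f ∉ regularAt p x} := by
    by_contra! hall
    have h0 := hcount.measure_zero (volume : Measure I)
    rw [eq_univ_of_forall hall, measure_univ] at h0
    exact one_ne_zero h0
  have hDx : D ⊆ regularAt p x := fun f hf => by
    by_contra hfx
    exact hx (mem_biUnion hf hfx)
  have hKx := hD _ (isClosedIdeal_regularAt x).isClosed hDx
  refine regularAt_ne_top (p := p) x (eq_top_iff.2 ?_)
  rw [← hKtop]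
  exact sInf_le ⟨isClosedIdeal_regularAt x, hKx⟩

end Regular

end Lorentz

/-- For `1 < p < ∞`: the norm of the Banach lattice `L_{p,∞}[0,1]` is equivalent to the Lorentz
quasi-norm, `χ_{[0,1]}` is a weak order unit, `L_{p,∞}[0,1]` is BWCG, it has no quasi-interior
point, and it is not IWCG. -/
theorem mainTheorem9 (p : ℝ) [hp : Fact (1 < p)] :
    (∀ f : Lorentz.weakLp p,
      Lorentz.quasiNorm p (f : Lorentz.L0) ≤ ENNReal.ofReal ‖f‖ ∧
        ENNReal.ofReal ‖f‖ ≤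
          ENNReal.ofReal (p / (p - 1)) * Lorentz.quasiNorm p (f : Lorentz.L0)) ∧
      IsWeakOrderUnit (Lorentz.chi p) ∧
      IsBWCG (Lorentz.weakLp p) ∧
      (¬ ∃ u : Lorentz.weakLp p, IsQuasiInteriorPoint u) ∧
      ¬ IsIWCG (Lorentz.weakLp p) := by
  refine ⟨fun f => ?_, Lorentz.isWeakOrderUnit_chi, Lorentz.isBWCG_weakLp,
    fun ⟨_, hu⟩ => Lorentz.not_isIWCG_weakLp hu.isIWCG, Lorentz.not_isIWCG_weakLp⟩
  rw [Lorentz.ofReal_norm_weakLp]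
  exact ⟨Lorentz.quasiNorm_le_maxNorm hp.out _, Lorentz.maxNorm_le_quasiNorm hp.out _⟩
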